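/- Let $d\ge 1$ and let $S\subset\mathbb{R}^d$ be a compact convex set with nonempty interior. For $x\in\mathbb{R}^d$ let $S_x$ denote the translate of $S$ whose centroid is at $x$; two such translates are said to overlap if they intersect. Given $L>0$, call a set $\eta\subset\mathbb{R}^d\setminus[0,L]^d$ admissible if the solids $S_y$, $y\in\eta$, are pairwise non-overlapping. Let $U_1,U_2,\dots$ be independent random vectors, each uniformly distributed on $[0,L)^d$. For an admissible $\eta$, consider the solids $S_{U_1},S_{U_2},\dots$ successively: $S_{U_i}$ is packed if it overlaps neither a solid $S_y$ with $y\in\eta$ nor a solid $S_{U_j}$ with $j<i$ that has already been packed; otherwise it is discarded. Let $N[[0,L]^d\,|\,\eta]$ be the total number of the solids $S_{U_1},S_{U_2},\dots$ that are packed in $[0,L]^d$, counted by their centroids. **Proposition 4.1.** Every such $S$ has jamming variability: there exists $L>0$ such that $$\inf_{\eta}\ \operatorname{Var} N[[0,L]^d\,|\,\eta]>0,$$ where the infimum is over all admissible sets $\eta\subset\mathbb{R}^d\setminus[0,L]^d$. -/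

import Mathlib

open MeasureTheory ProbabilityTheory
open scoped Pointwise

noncomputable section

/-- Euclidean space `ℝ^d`. -/
abbrev Space (d : ℕ) : Type := EuclideanSpace ℝ (Fin d)

/-- The closed cube `[0, L]^d`. -/
def closedCube (d : ℕ) (L : ℝ) : Set (Space d) :=
  {x | ∀ k, 0 ≤ x k ∧ x k ≤ L}

/-- The half-open cube `[0, L)^d`, in which the centroids of the arriving solids are sampled. -/
def halfOpenCube (d : ℕ) (L : ℝ) : Set (Space d) :=
  {x | ∀ k, 0 ≤ x k ∧ x k < L}

/-- The uniform distribution on `[0, L)^d`: normalized Lebesgue measure. -/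
def uniformCube (d : ℕ) (L : ℝ) : Measure (Space d) :=
  ProbabilityTheory.cond volume (halfOpenCube d L)

theorem volume_halfOpenCube (d : ℕ) (L : ℝ) :
    volume (halfOpenCube d L) = ENNReal.ofReal L ^ d := by
  have h : halfOpenCube d L =
      (MeasurableEquiv.toLp 2 (Fin d → ℝ)).symm ⁻¹'
        (Set.univ.pi fun _ : Fin d => Set.Ico (0 : ℝ) L) := by
    ext x
    simp [halfOpenCube, Set.mem_pi]
  rw [h, (EuclideanSpace.volume_preserving_symm_measurableEquiv_toLp (Fin d)).measure_preimage_equiv,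
    volume_pi_pi]
  simp

theorem isProbabilityMeasure_uniformCube (d : ℕ) {L : ℝ} (hL : 0 < L) :
    IsProbabilityMeasure (uniformCube d L) := by
  apply cond_isProbabilityMeasure_of_finite
  · rw [volume_halfOpenCube]
    exact pow_ne_zero _ (by simpa using hL)
  · rw [volume_halfOpenCube]
    exact ENNReal.pow_ne_top ENNReal.ofReal_ne_top

/-- The law of the infinite sequence `U 0, U 1, U 2, …` of independent random vectors, each
uniformly distributed on `[0, L)^d`. -/
def arrivalLaw (d : ℕ) (L : ℝ) (hL : 0 < L) : Measure (ℕ → Space d) :=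
  haveI : IsProbabilityMeasure (uniformCube d L) := isProbabilityMeasure_uniformCube d hL
  Measure.infinitePi fun _ : ℕ => uniformCube d L

/-- The centroid of `S`: the mean of the uniform distribution on `S`. -/
def bodyCentroid {d : ℕ} (S : ConvexBody (Space d)) : Space d :=
  ⨍ y in (S : Set (Space d)), y

/-- The translate of `S` whose centroid is at `x`. -/
def solidAt {d : ℕ} (S : ConvexBody (Space d)) (x : Space d) : Set (Space d) :=
  (x - bodyCentroid S) +ᵥ (S : Set (Space d))

/-- The solids centred at `x` and at `y` overlap, that is, they intersect. -/
def Overlap {d : ℕ} (S : ConvexBody (Space d)) (x y : Space d) : Prop :=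
  (solidAt S x ∩ solidAt S y).Nonempty

/-- `η` is an admissible pre-packed configuration outside `[0, L]^d`: its points lie outside the
cube, and the translates of `S` centred at distinct points of `η` do not overlap. -/
def Admissible {d : ℕ} (S : ConvexBody (Space d)) (L : ℝ) (η : Set (Space d)) : Prop :=
  η ⊆ (closedCube d L)ᶜ ∧ η.Pairwise fun x y => ¬ Overlap S x y

/-- Random sequential adsorption, in the order of the indices, in the presence of the pre-packed
configuration `η`: the solid centred at `u i` is packed if and only if it overlaps neither a solid
centred at a point of `η` nor an earlier solid of the sequence that has been packed. -/
def IsPacked {d : ℕ} (S : ConvexBody (Space d)) (η : Set (Space d)) (u : ℕ → Space d)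
    (i : ℕ) : Prop :=
  (∀ y ∈ η, ¬ Overlap S (u i) y) ∧
    ∀ j, j < i → IsPacked S η u j → ¬ Overlap S (u i) (u j)
termination_by i

/-- The number `N[[0, L]^d | η]` of solids of the sequence that are packed in `[0, L]^d`, given the
pre-packed configuration `η`. When `S` has interior points this set of indices is always finite:
the packed solids are disjoint translates of `S` with centroids in a bounded set. -/
def packingNumber {d : ℕ} (S : ConvexBody (Space d)) (L : ℝ) (η : Set (Space d))
    (u : ℕ → Space d) : ℕ :=
  {i | IsPacked S η u i ∧ u i ∈ closedCube d L}.ncard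

/-- Jamming variability: for some `L > 0`, the infimum over all admissible `η` of the variance of
`N[[0, L]^d | η]` is strictly positive. -/
def JammingVariability {d : ℕ} (S : ConvexBody (Space d)) : Prop :=
  ∃ (L : ℝ) (hL : 0 < L), ∃ ε : ℝ, 0 < ε ∧ ∀ η : Set (Space d), Admissible S L η →
    ε ≤ variance (fun u => (packingNumber S L η u : ℝ)) (arrivalLaw d L hL)

end

/-! Overlap of two solids means `g (x - y) ≤ 1`, where `g` is the gauge of the difference body of
`S` (`exists_overlap_seminorm`). The variance is bounded below by a local exchange that changes the
packing number without disturbing later arrivals.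

The exchange needs two finite hard-core sets `A` and `B` of different sizes, such that any location
in reach of a point of one but not the other is blocked by the other (`exists_robust_pair`). They
come from a periodic saturated set: a large block is replaced by a slightly contracted copy of a
block one period wider, which gains points, and the result is completed to a saturated set
(`exists_two_saturated`). Truncating both sets and shrinking them slightly turns strict separation
and saturation into estimates with a margin `δ`.

Suppose the first `K` arrivals fall near an enumeration of `A`; moving them by translation near one
of `B` preserves the arrival law (`map_swapBalls_uniformCube`). The first `K` arrivals then pack
`B.ncard` solids instead of `A.ncard`, while the same later arrivals are packed
(`isPacked_tail_iff`), so the total changes. The event has positive probability independent of `η`,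
since `A` and `B` lie deep inside the cube, and `variance_ge_of_measurePreserving` concludes. -/

noncomputable section PackingVariability

variable {d : ℕ} {g : Seminorm ℝ (Space d)}

/-! ### Hard-core configurations for a seminorm equivalent to the Euclidean norm -/

/-- A seminorm comparable to the Euclidean norm. -/
structure NormLike {d : ℕ} (g : Seminorm ℝ (Space d)) : Prop where
  lower : ∃ c : ℝ, 0 < c ∧ ∀ x, c * ‖x‖ ≤ g x
  upper : ∃ C : ℝ, 0 < C ∧ ∀ x, g x ≤ C * ‖x‖

/-- Distinct points of `X` are at `g`-distance more than `1`. -/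
def HardCore {d : ℕ} (g : Seminorm ℝ (Space d)) (X : Set (Space d)) : Prop :=
  X.Pairwise fun x y => 1 < g (x - y)

/-- Every point is at `g`-distance at most `1` from a point of `X`. -/
def Saturates {d : ℕ} (g : Seminorm ℝ (Space d)) (X : Set (Space d)) : Prop :=
  ∀ z, ∃ x ∈ X, g (z - x) ≤ 1

theorem HardCore.mono {X Y : Set (Space d)} (hY : HardCore g Y) (h : X ⊆ Y) : HardCore g X :=
  Set.Pairwise.mono h hY

/-- Finitely many balls of radius `1 / (2 * C)` cover the region, and each holds at most one point
of `X`, since two would be at `g`-distance less than `1`. -/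
theorem NormLike.exists_hardCore_bound (hg : NormLike g) (R : ℝ) :
    ∃ n : ℕ, ∀ X : Set (Space d), HardCore g X → (∀ x ∈ X, ‖x‖ ≤ R) → X.Finite ∧ X.ncard ≤ n := by
  obtain ⟨C, hC, hgC⟩ := hg.upper
  have htb : TotallyBounded (Metric.closedBall (0 : Space d) R) :=
    (isCompact_closedBall _ _).totallyBounded
  obtain ⟨t, ht, hcov⟩ := Metric.totallyBounded_iff.1 htb (1 / (2 * C)) (by positivity)
  refine ⟨t.ncard, fun X hX hR => ?_⟩
  have h : ∀ x ∈ X, ∃ y ∈ t, dist x y < 1 / (2 * C) := by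
    intro x hx
    have := hcov (show x ∈ Metric.closedBall (0 : Space d) R by simpa using hR x hx)
    simpa using this
  choose! f hft hfd using h
  have hinj : Set.InjOn f X := by
    intro x hx y hy hxy
    by_contra hne
    have h1 := hX hx hy hne
    have h2 : dist x y < 1 / C := by
      have h3 := dist_triangle_right x y (f x)
      have h4 := hfd x hx
      have h5 := hfd y hy
      rw [← hxy] at h5
      have : 1 / (2 * C) + 1 / (2 * C) = 1 / C := by field_simp; norm_num
      linarith
    rw [dist_eq_norm, lt_div_iff₀ hC] at h2
    linarith [hgC (x - y)]
  exact ⟨Set.Finite.of_injOn hft hinj ht, Set.ncard_le_ncard_of_injOn f hft hinj ht⟩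

theorem NormLike.norm_le (hg : NormLike g) (r : ℝ) : ∃ R : ℝ, ∀ x, g x ≤ r → ‖x‖ ≤ R := by
  obtain ⟨c, hc, h⟩ := hg.lower
  refine ⟨r / c, fun x hx => ?_⟩
  rw [le_div_iff₀ hc]
  linarith [h x]

theorem NormLike.continuous (hg : NormLike g) : Continuous g := by
  obtain ⟨C, hC, h⟩ := hg.upper
  refine (LipschitzWith.of_le_add_mul ⟨C, hC.le⟩ fun x y => ?_).continuous
  have h1 := map_add_le_add g y (x - y)
  rw [add_sub_cancel] at h1
  rw [dist_eq_norm]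
  exact h1.trans (add_le_add_right (h (x - y)) (g y))

theorem HardCore.countable (hg : NormLike g) {X : Set (Space d)} (hX : HardCore g X) :
    X.Countable := by
  have h : X ⊆ ⋃ n : ℕ, X ∩ {x | ‖x‖ ≤ n} := by
    intro x hx
    obtain ⟨n, hn⟩ := exists_nat_ge ‖x‖
    exact Set.mem_iUnion.2 ⟨n, hx, hn⟩
  refine (Set.countable_iUnion fun n : ℕ => ?_).mono h
  obtain ⟨m, hm⟩ := hg.exists_hardCore_bound n
  exact (hm _ (hX.mono Set.inter_subset_left) fun x hx => hx.2).1.countable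

theorem seminorm_sub_rev (g : Seminorm ℝ (Space d)) (x y : Space d) : g (x - y) = g (y - x) :=
  map_sub_rev g x y

theorem seminorm_sub_le (g : Seminorm ℝ (Space d)) (x y z : Space d) :
    g (x - z) ≤ g (x - y) + g (y - z) := by
  simpa using map_add_le_add g (x - y) (y - z)

theorem hardCore_sUnion {c : Set (Set (Space d))} (hc : IsChain (fun x1 x2 => x1 ⊆ x2) c)
    (h : ∀ X ∈ c, HardCore g X) : HardCore g (⋃₀ c) :=
  (Set.pairwise_sUnion hc.directedOn).2 h

theorem hardCore_union {X Y : Set (Space d)} (hX : HardCore g X) (hY : HardCore g Y)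
    (h : ∀ x ∈ X, ∀ y ∈ Y, x ≠ y → 1 < g (x - y)) : HardCore g (X ∪ Y) := by
  refine Set.pairwise_union.2 ⟨hX, hY, fun x hx y hy hne => ⟨h x hx y hy hne, ?_⟩⟩
  rw [seminorm_sub_rev]
  exact h x hx y hy hne

/-- A maximal hard-core set is saturated: an uncovered point could be added to it. -/
theorem exists_saturated_superset {X : Set (Space d)} (hX : HardCore g X) :
    ∃ A, X ⊆ A ∧ HardCore g A ∧ Saturates g A := by
  obtain ⟨A, hXA, hA⟩ := zorn_subset_nonempty {Y | HardCore g Y}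
    (fun c hc hch _ => ⟨⋃₀ c, hardCore_sUnion hch hc, fun s hs => Set.subset_sUnion_of_mem hs⟩)
    X hX
  refine ⟨A, hXA, hA.prop, fun z => ?_⟩
  by_contra! hz
  have h1 : HardCore g (insert z A) := by
    rw [Set.insert_eq]
    refine hardCore_union (Set.pairwise_singleton _ _) hA.prop fun x hx y hy _ => ?_
    rw [Set.mem_singleton_iff.1 hx]
    exact hz y hy
  have h2 : z ∈ A := hA.le_of_ge h1 (Set.subset_insert z A) (Set.mem_insert z A)
  have h3 := hz z h2
  rw [sub_self, map_zero] at h3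
  linarith

/-- Overlap of translates of a convex body is described by a norm-like seminorm, the gauge of the
difference body. -/
theorem exists_overlap_seminorm (S : ConvexBody (Space d))
    (hS : (interior (S : Set (Space d))).Nonempty) :
    ∃ g : Seminorm ℝ (Space d), NormLike g ∧ ∀ x y, Overlap S x y ↔ g (x - y) ≤ 1 := by
  set D : Set (Space d) := (S : Set (Space d)) - S with hD
  have hconv : Convex ℝ D := S.convex.sub S.convex
  have hcomp : IsCompact D := by
    rw [hD, sub_eq_add_neg]
    exact S.isCompact.add S.isCompact.neg
  have hnhds : D ∈ nhds (0 : Space d) := by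
    obtain ⟨s, hs⟩ := hS
    have h1 : interior (S : Set (Space d)) - (S : Set (Space d)) ⊆ D := Set.sub_subset_sub_right interior_subset
    have h2 : IsOpen (interior (S : Set (Space d)) - (S : Set (Space d))) := isOpen_interior.sub_right
    exact Filter.mem_of_superset (h2.mem_nhds ⟨s, hs, s, interior_subset hs, sub_self s⟩) h1
  have habs : Absorbent ℝ D := absorbent_nhds_zero hnhds
  have hbal : Balanced ℝ D := by
    rw [balanced_iff_neg_mem hconv]
    rintro x ⟨a, ha, b, hb, rfl⟩
    exact ⟨b, hb, a, ha, by simp⟩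
  refine ⟨gaugeSeminorm hbal hconv habs, ⟨?_, ?_⟩, fun x y => ?_⟩
  · obtain ⟨r, hr⟩ := hcomp.isBounded.subset_closedBall (0 : Space d)
    have hr' : D ⊆ Metric.closedBall 0 (max r 1) :=
      hr.trans (Metric.closedBall_subset_closedBall (le_max_left _ _))
    have hpos : 0 < max r 1 := lt_max_of_lt_right one_pos
    refine ⟨1 / max r 1, by positivity, fun x => ?_⟩
    have := le_gauge_of_subset_closedBall (x := x) habs hpos.le hr'
    change _ ≤ gauge D x
    rwa [one_div, inv_mul_eq_div]
  · obtain ⟨r, hr, hball⟩ := Metric.mem_nhds_iff.1 hnhds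
    refine ⟨1 / r, by positivity, fun x => ?_⟩
    have := mul_gauge_le_norm (x := x) hball
    change gauge D x ≤ _
    rw [one_div, inv_mul_eq_div, le_div_iff₀ hr]
    linarith
  · change _ ↔ gauge D (x - y) ≤ 1
    rw [gauge_le_one_iff_mem_closure hconv hnhds, hcomp.isClosed.closure_eq]
    constructor
    · rintro ⟨z, ⟨s, hs, rfl⟩, ⟨t, ht, h⟩⟩
      refine ⟨t, ht, s, hs, ?_⟩
      simp only [vadd_eq_add] at h
      rw [sub_eq_sub_iff_add_eq_add]
      have : y + t = x + s := by
        calc y + t = y - bodyCentroid S + t + bodyCentroid S := by abel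
          _ = x - bodyCentroid S + s + bodyCentroid S := by rw [h]
          _ = x + s := by abel
      rw [add_comm t y, this]
    · rintro ⟨t, ht, s, hs, h⟩
      refine ⟨x - bodyCentroid S + s, ⟨s, hs, rfl⟩, ⟨t, ht, ?_⟩⟩
      simp only [vadd_eq_add]
      have h' : t - s = x - y := h
      rw [sub_eq_sub_iff_add_eq_add] at h'
      rw [sub_add_eq_add_sub, sub_add_eq_add_sub, add_comm y t, h']

/-! ### Periodic saturated configurations -/

/-- The vector of the lattice `K ℤ^d` with integer coordinates `v`. -/
def latticeVec (K : ℝ) (v : Fin d → ℤ) : Space d := WithLp.toLp 2 fun i => K * v i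

@[simp] theorem latticeVec_apply (K : ℝ) (v : Fin d → ℤ) (i : Fin d) :
    latticeVec K v i = K * v i := rfl

/-- The half-open cube `[a, b)^d`. -/
def box (d : ℕ) (a b : ℝ) : Set (Space d) := {x | ∀ i, a ≤ x i ∧ x i < b}

theorem abs_coord_le_norm (x : Space d) (i : Fin d) : |x i| ≤ ‖x‖ := PiLp.norm_apply_le x i

theorem exists_norm_bound_box (d : ℕ) (a b : ℝ) : ∃ R : ℝ, ∀ x ∈ box d a b, ‖x‖ ≤ R := by
  refine ⟨∑ _i : Fin d, (|a| + |b|), fun x hx => ?_⟩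
  have h1 : ‖x‖ ≤ ∑ i, ‖x i‖ := by
    have h2 : x = ∑ i, x i • EuclideanSpace.single i (1 : ℝ) := by
      ext j
      simp [Finset.sum_apply, Pi.single_apply]
    calc ‖x‖ = ‖∑ i, x i • EuclideanSpace.single i (1 : ℝ)‖ := by rw [← h2]
      _ ≤ ∑ i, ‖x i • EuclideanSpace.single i (1 : ℝ)‖ := norm_sum_le _ _
      _ = ∑ i, ‖x i‖ := by simp [norm_smul]
  refine h1.trans (Finset.sum_le_sum fun i _ => ?_)
  rw [Real.norm_eq_abs, abs_le]
  have := hx i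
  constructor
  · linarith [neg_abs_le a, abs_nonneg b]
  · linarith [le_abs_self b, abs_nonneg a]

theorem NormLike.exists_coord_sep (hg : NormLike g) :
    ∃ K : ℝ, 0 < K ∧ ∀ (x : Space d) (i : Fin d), K ≤ |x i| → 1 < g x := by
  obtain ⟨c, hc, h⟩ := hg.lower
  refine ⟨2 / c, by positivity, fun x i hi => ?_⟩
  have h1 := hi.trans (abs_coord_le_norm x i)
  rw [div_le_iff₀ hc] at h1
  linarith [h x]

/-- Zorn's lemma is applied to periodic hard-core sets. The whole orbit of an uncovered point can be
added: distinct lattice translates differ by at least `K` in some coordinate, and periodicity of `X`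
carries the gap at `z` to its translates. -/
theorem exists_periodic_saturated {K : ℝ} (hK : 0 < K)
    (hKg : ∀ (x : Space d) (i : Fin d), K ≤ |x i| → 1 < g x) :
    ∃ X : Set (Space d), HardCore g X ∧ Saturates g X ∧
      ∀ (v : Fin d → ℤ), ∀ x ∈ X, x + latticeVec K v ∈ X := by
  obtain ⟨X, hX⟩ := zorn_subset
    {X : Set (Space d) | HardCore g X ∧ ∀ (v : Fin d → ℤ), ∀ x ∈ X, x + latticeVec K v ∈ X}
    (fun c hc hch => ⟨⋃₀ c, ⟨hardCore_sUnion hch fun X hX => (hc hX).1, by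
      rintro v x ⟨Y, hY, hx⟩
      exact ⟨Y, hY, (hc hY).2 v x hx⟩⟩, fun s hs => Set.subset_sUnion_of_mem hs⟩)
  refine ⟨X, hX.prop.1, fun z => ?_, hX.prop.2⟩
  by_contra! hz
  have hlat : ∀ v w : Fin d → ℤ, latticeVec K v + latticeVec K w = latticeVec K (v + w) := by
    intro v w
    ext i
    simp [mul_add]
  have hneg : ∀ v : Fin d → ℤ, latticeVec K (-v) = - latticeVec K v := by
    intro v
    ext i
    simp
  have h1 : X ∪ Set.range (fun v : Fin d → ℤ => z + latticeVec K v) ∈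
      {X : Set (Space d) | HardCore g X ∧ ∀ (v : Fin d → ℤ), ∀ x ∈ X, x + latticeVec K v ∈ X} := by
    refine ⟨hardCore_union hX.prop.1 ?_ ?_, ?_⟩
    · rintro _ ⟨v, rfl⟩ _ ⟨w, rfl⟩ hne
      have hvw : v ≠ w := fun h => hne (by rw [h])
      obtain ⟨i, hi⟩ := Function.ne_iff.1 hvw
      refine hKg _ i ?_
      have h2 : (1 : ℝ) ≤ |((v i - w i : ℤ) : ℝ)| := by
        rw [← Int.cast_abs]
        exact_mod_cast Int.one_le_abs (sub_ne_zero.2 hi)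
      have h3 : (z + latticeVec K v - (z + latticeVec K w)) i = K * ((v i - w i : ℤ) : ℝ) := by
        simp
        ring
      rw [h3, abs_mul, abs_of_pos hK]
      nlinarith
    · rintro x hx _ ⟨v, rfl⟩ -
      rw [seminorm_sub_rev]
      have := hz _ (hX.prop.2 (-v) x hx)
      rwa [hneg, ← sub_eq_add_neg, ← sub_add, sub_add_eq_add_sub] at this
    · rintro v x (hx | ⟨w, rfl⟩)
      · exact Or.inl (hX.prop.2 v x hx)
      · exact Or.inr ⟨w + v, by simp only [add_assoc, hlat]⟩
  have h2 : z ∈ X := by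
    refine hX.le_of_ge h1 Set.subset_union_left (Or.inr ⟨0, ?_⟩)
    ext i
    simp
  have h3 := hz z h2
  rw [sub_self, map_zero] at h3
  linarith

/-- The cap at `2` handles empty `T`, and it allows distant pairs to be ignored when a minimal
separation is sought. -/
theorem exists_gt_one_lower_bound {T : Set ℝ} (hT : T.Finite) (h : ∀ t ∈ T, 1 < t) :
    ∃ m, 1 < m ∧ m ≤ 2 ∧ ∀ t ∈ T, m ≤ t := by
  rcases T.eq_empty_or_nonempty with rfl | hne
  · exact ⟨2, by norm_num, le_rfl, by simp⟩
  · obtain ⟨m, hm, hmin⟩ := hT.exists_minimal hne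
    refine ⟨min m 2, lt_min (h m hm) (by norm_num), min_le_right _ _, fun t ht => ?_⟩
    rcases le_total m t with h' | h'
    · exact (min_le_left _ _).trans h'
    · exact (min_le_left _ _).trans (hmin ht h')

theorem exists_translate_mem_box {K : ℝ} (hK : 0 < K) (x : Space d) :
    ∃ v : Fin d → ℤ, x + latticeVec K v ∈ box d 0 K := by
  refine ⟨fun i => -⌊x i / K⌋, fun i => ?_⟩
  have h1 := Int.floor_le (x i / K)
  have h2 := Int.lt_floor_add_one (x i / K)
  rw [le_div_iff₀ hK] at h1
  rw [div_lt_iff₀ hK] at h2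
  simp only [PiLp.add_apply, latticeVec_apply, Int.cast_neg]
  constructor <;> nlinarith

/-- Up to periods, only finitely many pairs of points are at `g`-distance less than `2`, so the
strict hard-core inequality is uniform. -/
theorem exists_min_separation (hg : NormLike g) {K : ℝ} (hK : 0 < K) {X : Set (Space d)}
    (hX : HardCore g X) (hper : ∀ (v : Fin d → ℤ), ∀ x ∈ X, x + latticeVec K v ∈ X) :
    ∃ m : ℝ, 1 < m ∧ ∀ x ∈ X, ∀ y ∈ X, x ≠ y → m ≤ g (x - y) := by
  obtain ⟨R, hR⟩ := exists_norm_bound_box d 0 K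
  obtain ⟨R', hR'⟩ := hg.norm_le 2
  have hfin : (X ∩ {x | ‖x‖ ≤ R + R'}).Finite := by
    obtain ⟨n, hn⟩ := hg.exists_hardCore_bound (R + R')
    exact (hn _ (hX.mono Set.inter_subset_left) fun x hx => hx.2).1
  obtain ⟨m, hm1, hm2, hm⟩ := exists_gt_one_lower_bound
    (((hfin.prod hfin).sep fun p => p.1 ≠ p.2).image fun p => g (p.1 - p.2))
    (by rintro _ ⟨p, ⟨⟨hp1, hp2⟩, hne⟩, rfl⟩; exact hX hp1.1 hp2.1 hne)
  refine ⟨m, hm1, fun x hx y hy hne => ?_⟩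
  by_contra! hlt
  obtain ⟨v, hv⟩ := exists_translate_mem_box hK x
  have heq : (x + latticeVec K v) - (y + latticeVec K v) = x - y := by abel
  have hxR := hR _ hv
  have h0 : 0 ≤ R' := (norm_nonneg (0 : Space d)).trans (hR' 0 (by simp))
  have hyR : ‖y + latticeVec K v‖ ≤ R + R' := by
    have h1 : y + latticeVec K v = (x + latticeVec K v) - (x - y) := by abel
    rw [h1]
    exact (norm_sub_le _ _).trans (add_le_add hxR (hR' _ (by linarith)))
  have h2 := hm (g (x - y)) ⟨(x + latticeVec K v, y + latticeVec K v),
    ⟨⟨⟨hper v x hx, hxR.trans (by linarith)⟩, ⟨hper v y hy, hyR⟩⟩,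
      fun h => hne (add_right_cancel h)⟩, by simp only [heq]⟩
  linarith

/-- Two saturated hard-core configurations that agree far away, one of which has more points: a
periodic saturated configuration, and a saturated one that contains a slightly contracted copy of
a block of it. -/
theorem exists_two_saturated (hd : 1 ≤ d) (hg : NormLike g) :
    ∃ (X A : Set (Space d)) (r₀ : ℝ), HardCore g X ∧ Saturates g X ∧ HardCore g A ∧
      Saturates g A ∧ (∀ z, r₀ < g z → (z ∈ X ↔ z ∈ A)) ∧
      ∀ r, r₀ ≤ r → (X ∩ {z | g z ≤ r}).ncard < (A ∩ {z | g z ≤ r}).ncard := by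
  obtain ⟨K, hK, hKg⟩ := hg.exists_coord_sep
  obtain ⟨X, hX, hXs, hper⟩ := exists_periodic_saturated hK hKg
  obtain ⟨m, hm1, hm⟩ := exists_min_separation hg hK hX hper
  obtain ⟨n, hn⟩ := exists_nat_gt (1 / (m - 1))
  have hm0 : 0 < m - 1 := by linarith
  have hn0 : (0 : ℝ) < n := lt_trans (by positivity) hn
  rw [div_lt_iff₀ hm0] at hn
  -- The choice of `n` gives `θ * m > 1`, so contraction by `θ` keeps the hard core. It takes side
  -- `3(n+1)K` to `3nK`, which leaves a collar of width `K` on each side within the removed block of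
  -- side `(3n+2)K`.
  set θ : ℝ := n / (n + 1) with hθ
  have hθ0 : 0 < θ := by positivity
  have hθn : θ * (n + 1) = n := by rw [hθ]; field_simp
  have hθm : 1 < θ * m := by
    rw [hθ, div_mul_eq_mul_div, lt_div_iff₀ (by positivity)]
    linarith
  set Q : Set (Space d) := box d 0 ((3 * n + 2) * K) with hQ
  set P : Set (Space d) := box d 0 ((3 * n + 3) * K) with hP
  set ψ : Space d → Space d := fun x => θ • x + latticeVec K fun _ => 1 with hψ
  have hψsub : ∀ x y, ψ x - ψ y = θ • (x - y) := by
    intro x y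
    simp only [hψ, smul_sub]
    abel
  have hψg : ∀ x y, g (ψ x - ψ y) = θ * g (x - y) := by
    intro x y
    rw [hψsub, map_smul_eq_mul, Real.norm_of_nonneg hθ0.le]
  have hψmem : ∀ x ∈ P, ψ x ∈ box d K ((3 * n + 1) * K) := by
    intro x hx i
    obtain ⟨h1, h2⟩ := hx i
    have h3 : (ψ x) i = θ * x i + K := by simp [hψ]
    rw [h3]
    constructor
    · nlinarith
    · have h4 : θ * x i < θ * ((3 * n + 3) * K) := mul_lt_mul_of_pos_left h2 hθ0
      have h5 : θ * ((3 * n + 3) * K) = 3 * (θ * (n + 1)) * K := by ring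
      rw [h5, hθn] at h4
      linarith
  have hψQ : ∀ x ∈ P, ψ x ∈ Q := by
    intro x hx i
    obtain ⟨h1, h2⟩ := hψmem x hx i
    constructor <;> nlinarith
  have hPQ : Q ⊆ P := fun x hx i => ⟨(hx i).1, (hx i).2.trans (by nlinarith)⟩
  have hA₀ : HardCore g ((X \ Q) ∪ ψ '' (X ∩ P)) := by
    refine hardCore_union (hX.mono Set.sdiff_subset) ?_ ?_
    · rintro _ ⟨x, hx, rfl⟩ _ ⟨y, hy, rfl⟩ hne
      have h1 := hm x hx.1 y hy.1 fun h => hne (by rw [h])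
      change 1 < g (ψ x - ψ y)
      rw [hψg]
      nlinarith
    · rintro x ⟨hx, hxQ⟩ _ ⟨y, hy, rfl⟩ -
      have h1 : ∃ i, ¬ (0 ≤ x i ∧ x i < (3 * n + 2) * K) := by
        by_contra! h
        exact hxQ h
      obtain ⟨i, hi⟩ := h1
      obtain ⟨h2, h3⟩ := hψmem y hy.2 i
      refine hKg _ i ?_
      rw [PiLp.sub_apply]
      by_cases h4 : 0 ≤ x i
      · have h5 : (3 * n + 2) * K ≤ x i := by
          by_contra! h
          exact hi ⟨h4, h⟩
        exact le_trans (by linarith) (le_abs_self _)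
      · exact le_trans (by linarith) (neg_le_abs _)
  obtain ⟨A, hA₀A, hA, hAs⟩ := exists_saturated_superset hA₀
  obtain ⟨C, hC, hgC⟩ := hg.upper
  obtain ⟨R, hR⟩ := exists_norm_bound_box d 0 ((3 * n + 2) * K)
  have hgQ : ∀ x ∈ Q, g x ≤ C * R := fun x hx =>
    (hgC x).trans (mul_le_mul_of_nonneg_left (hR x hx) hC.le)
  refine ⟨X, A, C * R + 1, hX, hXs, hA, hAs, fun z hz => ⟨fun h => hA₀A (Or.inl ⟨h, fun hq => ?_⟩),
    fun h => ?_⟩, fun r hr => ?_⟩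
  · linarith [hgQ z hq]
  -- The point of `X` covering a far `z` lies outside `Q`, hence in `A`; the hard core of `A` forces
  -- `z` to equal it.
  · obtain ⟨x, hx, hxz⟩ := hXs z
    have h1 : x ∉ Q := by
      intro hq
      have := map_add_le_add g (z - x) x
      rw [sub_add_cancel] at this
      linarith [hgQ x hq]
    have h2 : x ∈ A := hA₀A (Or.inl ⟨hx, h1⟩)
    by_contra hzX
    have h3 : z ≠ x := fun h' => hzX (h' ▸ hx)
    linarith [hA h h2 h3]
  · obtain ⟨R', hR'⟩ := hg.norm_le r
    obtain ⟨k, hk⟩ := hg.exists_hardCore_bound R'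
    have hAfin : (A ∩ {z | g z ≤ r}).Finite :=
      (hk _ (hA.mono Set.inter_subset_left) fun x hx => hR' x hx.2).1
    have hXfin : (X ∩ {z | g z ≤ r}).Finite :=
      (hk _ (hX.mono Set.inter_subset_left) fun x hx => hR' x hx.2).1
    have hsub : ψ '' (X ∩ P) ∪ (X \ Q) ∩ {z | g z ≤ r} ⊆ A ∩ {z | g z ≤ r} := by
      rintro x (⟨y, hy, rfl⟩ | hx)
      · refine ⟨hA₀A (Or.inr ⟨y, hy, rfl⟩), ?_⟩
        have := hgQ _ (hψQ y hy.2)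
        change g (ψ y) ≤ r
        linarith
      · exact ⟨hA₀A (Or.inl hx.1), hx.2⟩
    have hdisj : Disjoint (ψ '' (X ∩ P)) ((X \ Q) ∩ {z | g z ≤ r}) := by
      rw [Set.disjoint_left]
      rintro _ ⟨y, hy, rfl⟩ hx
      exact hx.1.2 (hψQ y hy.2)
    have hinj : Set.InjOn ψ (X ∩ P) := by
      intro x _ y _ hxy
      have h1 : θ • (x - y) = 0 := by rw [← hψsub, hxy, sub_self]
      exact sub_eq_zero.1 ((smul_eq_zero.1 h1).resolve_left hθ0.ne')
    have hXPfin : (X ∩ P).Finite := by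
      refine Set.Finite.of_finite_image (hAfin.subset ?_) hinj
      exact Set.subset_union_left.trans hsub
    have hrest : ((X \ Q) ∩ {z | g z ≤ r}).Finite :=
      hAfin.subset (Set.subset_union_right.trans hsub)
    -- A point of `X` in the first period cell, moved by `3n+2` periods in every coordinate, lies in
    -- `P` but not in `Q`; `d ≥ 1` supplies a coordinate witnessing this.
    have hlt : (X ∩ Q).ncard < (X ∩ P).ncard := by
      refine Set.ncard_lt_ncard ⟨Set.inter_subset_inter_right _ hPQ, fun h => ?_⟩ hXPfin
      obtain ⟨x, hx, -⟩ := hXs 0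
      obtain ⟨v, hv⟩ := exists_translate_mem_box hK x
      have hmem := hper (fun _ => 3 * n + 2) _ (hper v x hx)
      have hcoord : ∀ i, (x + latticeVec K v + latticeVec K (fun _ => (3 * n + 2 : ℤ)) : Space d) i =
          (x + latticeVec K v) i + (3 * n + 2) * K := by
        intro i
        simp
        ring
      have hPmem : x + latticeVec K v + latticeVec K (fun _ => (3 * n + 2 : ℤ)) ∈ P := by
        intro i
        rw [hcoord]
        obtain ⟨h1, h2⟩ := hv i
        constructor
        · positivity
        · linarith
      have h1 := ((h ⟨hmem, hPmem⟩).2 ⟨0, hd⟩).2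
      rw [hcoord] at h1
      linarith [(hv ⟨0, hd⟩).1]
    calc (X ∩ {z | g z ≤ r}).ncard
        ≤ ((X ∩ Q) ∪ ((X \ Q) ∩ {z | g z ≤ r})).ncard := by
          refine Set.ncard_le_ncard (fun x hx => ?_)
            ((hXPfin.subset (Set.inter_subset_inter_right _ hPQ)).union hrest)
          by_cases hq : x ∈ Q
          · exact Or.inl ⟨hx.1, hq⟩
          · exact Or.inr ⟨⟨hx.1, hq⟩, hx.2⟩
      _ ≤ (X ∩ Q).ncard + ((X \ Q) ∩ {z | g z ≤ r}).ncard := Set.ncard_union_le _ _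
      _ < (X ∩ P).ncard + ((X \ Q) ∩ {z | g z ≤ r}).ncard := by omega
      _ = (ψ '' (X ∩ P)).ncard + ((X \ Q) ∩ {z | g z ≤ r}).ncard := by
          rw [hinj.ncard_image]
      _ = (ψ '' (X ∩ P) ∪ (X \ Q) ∩ {z | g z ≤ r}).ncard :=
          (Set.ncard_union_eq hdisj (hXPfin.image _) hrest).symm
      _ ≤ (A ∩ {z | g z ≤ r}).ncard := Set.ncard_le_ncard hsub hAfin

/-- Every point that nearly overlaps a point of `D` is covered by `A`, with margin `δ`. -/
def CoversNear (g : Seminorm ℝ (Space d)) (δ : ℝ) (D A : Set (Space d)) : Prop :=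
  ∀ a ∈ D, ∀ z, g (z - a) ≤ 1 + δ → ∃ x ∈ A, g (z - x) ≤ 1 - δ

/-- Distinct points of `A` are at `g`-distance more than `1 + δ`. -/
def SeparatedBy (g : Seminorm ℝ (Space d)) (δ : ℝ) (A : Set (Space d)) : Prop :=
  A.Pairwise fun x y => 1 + δ < g (x - y)

/-- Two finite configurations of different cardinalities which are robustly hard-core, and both of
which robustly shield every location that interacts with their difference. -/
theorem exists_robust_pair (hd : 1 ≤ d) (hg : NormLike g) :
    ∃ (A B : Set (Space d)) (δ : ℝ), A.Finite ∧ B.Finite ∧ A.ncard ≠ B.ncard ∧ 0 < δ ∧ δ ≤ 1 ∧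
      SeparatedBy g δ A ∧ SeparatedBy g δ B ∧ CoversNear g δ (A \ B) B ∧ CoversNear g δ (B \ A) A := by
  obtain ⟨X, Y, r₀, hX, hXs, hY, hYs, hXY, hcard⟩ := exists_two_saturated hd hg
  set W : Set (Space d) := {z | g z ≤ r₀ + 4} with hW
  obtain ⟨R, hR⟩ := hg.norm_le (r₀ + 4)
  obtain ⟨n, hn⟩ := hg.exists_hardCore_bound R
  have hfin : ∀ Z : Set (Space d), HardCore g Z → (Z ∩ W).Finite := fun Z hZ =>
    (hn _ (hZ.mono Set.inter_subset_left) fun x hx => hR x hx.2).1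
  have hsep : ∀ Z : Set (Space d), HardCore g Z →
      ∃ m, 1 < m ∧ m ≤ 2 ∧ ∀ x ∈ Z ∩ W, ∀ y ∈ Z ∩ W, x ≠ y → m ≤ g (x - y) := by
    intro Z hZ
    obtain ⟨m, h1, h2, h3⟩ := exists_gt_one_lower_bound
      ((((hfin Z hZ).prod (hfin Z hZ)).sep fun p => p.1 ≠ p.2).image fun p => g (p.1 - p.2))
      (by rintro _ ⟨p, ⟨⟨hp1, hp2⟩, hne⟩, rfl⟩; exact hZ hp1.1 hp2.1 hne)
    exact ⟨m, h1, h2, fun x hx y hy hne => h3 _ ⟨(x, y), ⟨⟨hx, hy⟩, hne⟩, rfl⟩⟩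
  obtain ⟨m₁, h11, h12, hm₁⟩ := hsep X hX
  obtain ⟨m₂, h21, h22, hm₂⟩ := hsep Y hY
  obtain ⟨m, hm1, hm2, hmm₁, hmm₂⟩ : ∃ m, 1 < m ∧ m ≤ 2 ∧ m ≤ m₁ ∧ m ≤ m₂ :=
    ⟨min m₁ m₂, lt_min h11 h21, (min_le_left _ _).trans h12, min_le_left _ _, min_le_right _ _⟩
  -- Scaling by `s` splits the slack: separation `m` becomes `(1 + m) / 2 > 1`, and covering radius
  -- `1` becomes `s < 1`.
  obtain ⟨s, hs⟩ : ∃ s : ℝ, s = (1 + m) / (2 * m) := ⟨_, rfl⟩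
  have hsm : s * m = (1 + m) / 2 := by rw [hs]; field_simp
  have hs1 : s < 1 := by
    rw [hs, div_lt_one (by linarith)]
    linarith
  have hs34 : 3 / 4 ≤ s := by
    rw [hs, le_div_iff₀ (by linarith)]
    linarith
  have hs0 : 0 < s := by linarith
  obtain ⟨δ, hδ0, hδs, hδm⟩ : ∃ δ : ℝ, 0 < δ ∧ δ ≤ 1 - s ∧ δ ≤ (m - 1) / 4 :=
    ⟨min (1 - s) ((m - 1) / 4), lt_min (by linarith) (by linarith), min_le_left _ _,
      min_le_right _ _⟩
  have hgs : ∀ x y : Space d, g (s • x - s • y) = s * g (x - y) := by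
    intro x y
    rw [← smul_sub, map_smul_eq_mul, Real.norm_of_nonneg hs0.le]
  have hinj : Function.Injective fun x : Space d => s • x := smul_right_injective _ hs0.ne'
  have hsepBy : ∀ (Z : Set (Space d)) (m' : ℝ), m ≤ m' →
      (∀ x ∈ Z ∩ W, ∀ y ∈ Z ∩ W, x ≠ y → m' ≤ g (x - y)) →
      SeparatedBy g δ ((fun x : Space d => s • x) '' (Z ∩ W)) := by
    rintro Z m' hm' hZ _ ⟨x, hx, rfl⟩ _ ⟨y, hy, rfl⟩ hne
    have h1 := hZ x hx y hy fun h => hne (by rw [h])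
    change 1 + δ < g (s • x - s • y)
    rw [hgs]
    nlinarith
  have hcov : ∀ Z Z' : Set (Space d), Saturates g Z → (∀ z, r₀ < g z → z ∈ Z' → z ∈ Z) →
      CoversNear g δ (((fun x : Space d => s • x) '' (Z' ∩ W)) \
        ((fun x : Space d => s • x) '' (Z ∩ W))) ((fun x : Space d => s • x) '' (Z ∩ W)) := by
    rintro Z Z' hZ hfar _ ⟨⟨a, ha, rfl⟩, hna⟩ z hz
    have ha0 : g a ≤ r₀ := by
      by_contra! h
      exact hna ⟨a, ⟨hfar a h ha.1, ha.2⟩, rfl⟩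
    obtain ⟨x, hx, hxz⟩ := hZ (s⁻¹ • z)
    have hz' : z = s • (s⁻¹ • z) := by rw [smul_smul, mul_inv_cancel₀ hs0.ne', one_smul]
    simp only at hz
    have h1 : s * g (s⁻¹ • z - a) ≤ 1 + δ := by rwa [← hgs, ← hz']
    have h2 : g (s⁻¹ • z - a) ≤ 3 := by nlinarith
    -- A differing point has `g a ≤ r₀`, and its coverer `x` is within `3 + 1` of it. Hence
    -- truncation to `W` loses no coverer that is needed.
    have h3 : g x ≤ r₀ + 4 := by
      have h4 := seminorm_sub_le g x (s⁻¹ • z) a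
      have h5 := map_add_le_add g (x - a) a
      rw [sub_add_cancel] at h5
      rw [seminorm_sub_rev g x (s⁻¹ • z)] at h4
      linarith
    refine ⟨s • x, ⟨x, ⟨hx, h3⟩, rfl⟩, ?_⟩
    rw [hz', hgs]
    nlinarith
  refine ⟨(fun x : Space d => s • x) '' (X ∩ W), (fun x : Space d => s • x) '' (Y ∩ W), δ,
    (hfin X hX).image _, (hfin Y hY).image _, ?_, hδ0, by linarith, hsepBy X m₁ hmm₁ hm₁,
    hsepBy Y m₂ hmm₂ hm₂, hcov Y X hYs fun z h h' => (hXY z h).1 h',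
    hcov X Y hXs fun z h h' => (hXY z h).2 h'⟩
  rw [Set.ncard_image_of_injective _ hinj, Set.ncard_image_of_injective _ hinj]
  exact (hcard _ (by linarith)).ne

/-! ### Sequences whose first terms are close to prescribed targets -/

theorem isPacked_iff (S : ConvexBody (Space d)) (η : Set (Space d)) (u : ℕ → Space d) (i : ℕ) :
    IsPacked S η u i ↔ (∀ y ∈ η, ¬ Overlap S (u i) y) ∧
      ∀ j, j < i → IsPacked S η u j → ¬ Overlap S (u i) (u j) := by
  rw [IsPacked]

/-- The first `K` terms of `u` lie in the cube, close to the targets `f`, and out of reach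
of `η`. -/
structure NearTargets (S : ConvexBody (Space d)) (g : Seminorm ℝ (Space d)) (L : ℝ)
    (η : Set (Space d)) (δ : ℝ) (K : ℕ) (f u : ℕ → Space d) : Prop where
  le_one : δ ≤ 1
  nonneg : 0 ≤ δ
  separated : SeparatedBy g δ (f '' Set.Iio K)
  near : ∀ i < K, g (u i - f i) ≤ δ / 2
  far : ∀ i < K, ∀ y ∈ η, ¬ Overlap S (u i) y
  mem : ∀ i < K, u i ∈ closedCube d L

section

variable {S : ConvexBody (Space d)} {L δ : ℝ} {η : Set (Space d)} {K k : ℕ}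
  {f fA fB u v : ℕ → Space d}

/-- Arrivals with the same target are within `δ ≤ 1` and overlap; those with distinct targets stay
more than `1 + δ - δ = 1` apart. So exactly the first visit to each target is packed. -/
theorem NearTargets.isPacked_iff_first (h : NearTargets S g L η δ K f u)
    (hov : ∀ x y, Overlap S x y ↔ g (x - y) ≤ 1) (i : ℕ) (hi : i < K) :
    IsPacked S η u i ↔ ∀ j < i, f j ≠ f i := by
  induction i using Nat.strong_induction_on with
  | _ i ih =>
    rw [isPacked_iff]
    constructor
    · rintro ⟨-, h2⟩ j hj hfj
      classical
      have hex : ∃ j, f j = f i := ⟨j, hfj⟩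
      have hle : Nat.find hex ≤ j := Nat.find_min' hex hfj
      have heq := Nat.find_spec hex
      have hlt : Nat.find hex < i := hle.trans_lt hj
      have hp := (ih _ hlt (hlt.trans hi)).2 fun j' hj' hfj' =>
        Nat.find_min hex hj' (hfj'.trans heq)
      refine h2 _ hlt hp ((hov _ _).2 ?_)
      have h3 := h.near i hi
      have h4 := h.near _ (hlt.trans hi)
      rw [heq, seminorm_sub_rev] at h4
      linarith [seminorm_sub_le g (u i) (f i) (u (Nat.find hex)), h.le_one]
    · intro hfirst
      refine ⟨h.far i hi, fun j hj _ hO => ?_⟩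
      rw [hov] at hO
      have h1 : 1 + δ < g (f i - f j) :=
        h.separated ⟨i, hi, rfl⟩ ⟨j, hj.trans hi, rfl⟩ (hfirst j hj).symm
      have h2 := h.near i hi
      have h3 := h.near j (hj.trans hi)
      rw [seminorm_sub_rev] at h2
      linarith [seminorm_sub_le g (f i) (u i) (f j), seminorm_sub_le g (u i) (u j) (f j)]

theorem NearTargets.exists_isPacked (h : NearTargets S g L η δ K f u)
    (hov : ∀ x y, Overlap S x y ↔ g (x - y) ≤ 1) {a : Space d} (ha : a ∈ f '' Set.Iio K) :
    ∃ i < K, f i = a ∧ IsPacked S η u i := by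
  classical
  obtain ⟨j, hj, hja⟩ := ha
  have hex : ∃ i, f i = a := ⟨j, hja⟩
  have hlt : Nat.find hex < K := (Nat.find_min' hex hja).trans_lt hj
  refine ⟨Nat.find hex, hlt, Nat.find_spec hex, ?_⟩
  rw [h.isPacked_iff_first hov _ hlt]
  intro i hi hfi
  exact Nat.find_min hex hi (hfi.trans (Nat.find_spec hex))

theorem NearTargets.ncard_prefix (h : NearTargets S g L η δ K f u)
    (hov : ∀ x y, Overlap S x y ↔ g (x - y) ≤ 1) :
    {i | i < K ∧ IsPacked S η u i}.ncard = (f '' Set.Iio K).ncard := by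
  have himg : f '' {i | i < K ∧ IsPacked S η u i} = f '' Set.Iio K := by
    refine Set.Subset.antisymm (Set.image_mono fun i hi => hi.1) fun a ha => ?_
    obtain ⟨i, hi, hia, hp⟩ := h.exists_isPacked hov ha
    exact ⟨i, ⟨hi, hp⟩, hia⟩
  rw [← himg]
  refine (Set.InjOn.ncard_image ?_).symm
  rintro i ⟨hi, hpi⟩ j ⟨hj, hpj⟩ hij
  rw [h.isPacked_iff_first hov _ hi] at hpi
  rw [h.isPacked_iff_first hov _ hj] at hpj
  rcases lt_trichotomy i j with hlt | heq | hlt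
  · exact absurd hij (hpj i hlt)
  · exact heq
  · exact absurd hij.symm (hpi j hlt)

/-- Suppose an earlier solid of `v` blocks arrival `i`. If it belongs to the tail, induction
applies. If its target is common to both sequences, its index is below `k`, where they coincide.
Otherwise its target is within `1 + δ/2` of `v i`, so `CoversNear` gives a target of `u` within `1 -
δ`, whose packed solid blocks `i` too. -/
theorem isPacked_tail_step (hov : ∀ x y, Overlap S x y ↔ g (x - y) ≤ 1)
    (hA : NearTargets S g L η δ K fA u) (hB : NearTargets S g L η δ K fB v)
    (hag : ∀ i < k, fA i = fB i) (huv : ∀ i, i < k ∨ K ≤ i → u i = v i)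
    (himg : fA '' Set.Iio K ∩ fB '' Set.Iio K ⊆ fB '' Set.Iio k)
    (hcov : CoversNear g δ (fB '' Set.Iio K \ fA '' Set.Iio K) (fA '' Set.Iio K))
    {i : ℕ} (hi : K ≤ i) (ih : ∀ j, K ≤ j → j < i → (IsPacked S η u j ↔ IsPacked S η v j))
    (hp : IsPacked S η u i) : IsPacked S η v i := by
  rw [isPacked_iff] at hp ⊢
  have hui := huv i (Or.inr hi)
  rw [hui] at hp
  refine ⟨hp.1, fun j hj hpj hO => ?_⟩
  rcases le_or_gt K j with hjK | hjK
  · refine hp.2 j hj ((ih j hjK hj).2 hpj) ?_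
    rwa [huv j (Or.inr hjK)]
  by_cases hmem : fB j ∈ fA '' Set.Iio K
  · obtain ⟨j₀, hj₀, hj₀j⟩ := himg ⟨hmem, ⟨j, hjK, rfl⟩⟩
    have hfirst := (hB.isPacked_iff_first hov j hjK).1 hpj
    have hjk : j < k := by
      refine lt_of_le_of_lt ?_ hj₀
      by_contra! hlt
      exact hfirst j₀ hlt hj₀j
    refine hp.2 j hj ((hA.isPacked_iff_first hov j hjK).2 fun j' hj' => ?_) ?_
    · rw [hag j hjk, hag j' (hj'.trans hjk)]
      exact hfirst j' hj'
    · rwa [huv j (Or.inl hjk)]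
  · rw [hov] at hO
    have h1 := hB.near j hjK
    have hδ := hA.nonneg
    obtain ⟨x, hx, hxz⟩ := hcov (fB j) ⟨⟨j, hjK, rfl⟩, hmem⟩ (v i)
      (by linarith [seminorm_sub_le g (v i) (v j) (fB j)])
    obtain ⟨i', hi', rfl, hp'⟩ := hA.exists_isPacked hov hx
    refine hp.2 i' (hi'.trans_le hi) hp' ((hov _ _).2 ?_)
    have h2 := hA.near i' hi'
    rw [seminorm_sub_rev] at h2
    linarith [seminorm_sub_le g (v i) (fA i') (u i')]

theorem isPacked_tail_iff (hov : ∀ x y, Overlap S x y ↔ g (x - y) ≤ 1)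
    (hA : NearTargets S g L η δ K fA u) (hB : NearTargets S g L η δ K fB v)
    (hag : ∀ i < k, fA i = fB i) (huv : ∀ i, i < k ∨ K ≤ i → u i = v i)
    (himgA : fA '' Set.Iio K ∩ fB '' Set.Iio K ⊆ fA '' Set.Iio k)
    (himgB : fA '' Set.Iio K ∩ fB '' Set.Iio K ⊆ fB '' Set.Iio k)
    (hcovA : CoversNear g δ (fA '' Set.Iio K \ fB '' Set.Iio K) (fB '' Set.Iio K))
    (hcovB : CoversNear g δ (fB '' Set.Iio K \ fA '' Set.Iio K) (fA '' Set.Iio K))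
    (i : ℕ) (hi : K ≤ i) : IsPacked S η u i ↔ IsPacked S η v i := by
  induction i using Nat.strong_induction_on with
  | _ i ih =>
    refine ⟨isPacked_tail_step hov hA hB hag huv himgB hcovB hi fun j hj hji => ih j hji hj,
      isPacked_tail_step hov hB hA (fun i h => (hag i h).symm) (fun i h => (huv i h).symm) ?_
        hcovA hi fun j hj hji => (ih j hji hj).symm⟩
    rwa [Set.inter_comm]

/-- The number of packed solids is bounded. -/
theorem exists_packed_bound (hg : NormLike g) (hov : ∀ x y, Overlap S x y ↔ g (x - y) ≤ 1)
    (L : ℝ) : ∃ n : ℕ, ∀ (η : Set (Space d)) (u : ℕ → Space d),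
      {i | IsPacked S η u i ∧ u i ∈ closedCube d L}.Finite ∧ packingNumber S L η u ≤ n := by
  -- `L + 1` makes the half-open box contain the closed cube.
  obtain ⟨R, hR⟩ := exists_norm_bound_box d 0 (L + 1)
  obtain ⟨n, hn⟩ := hg.exists_hardCore_bound R
  refine ⟨n, fun η u => ?_⟩
  have hsep : ∀ i j, IsPacked S η u i → IsPacked S η u j → i ≠ j → 1 < g (u i - u j) := by
    have hlt : ∀ i j, IsPacked S η u i → IsPacked S η u j → j < i → 1 < g (u i - u j) := by
      intro i j hi hj hji
      rw [isPacked_iff] at hi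
      have := hi.2 j hji hj
      rwa [hov, not_le] at this
    intro i j hi hj hij
    rcases lt_or_gt_of_ne hij with h | h
    · rw [seminorm_sub_rev]
      exact hlt j i hj hi h
    · exact hlt i j hi hj h
  have hinj : Set.InjOn u {i | IsPacked S η u i ∧ u i ∈ closedCube d L} := by
    rintro i ⟨hi, -⟩ j ⟨hj, -⟩ hij
    by_contra hne
    have := hsep i j hi hj hne
    rw [hij, sub_self, map_zero] at this
    linarith
  have himg := hn (u '' {i | IsPacked S η u i ∧ u i ∈ closedCube d L}) (by
    rintro _ ⟨i, ⟨hi, -⟩, rfl⟩ _ ⟨j, ⟨hj, -⟩, rfl⟩ hne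
    exact hsep i j hi hj fun h => hne (by rw [h])) (by
    rintro _ ⟨i, ⟨-, hi⟩, rfl⟩
    exact hR _ fun l => ⟨(hi l).1, (hi l).2.trans_lt (by linarith)⟩)
  refine ⟨Set.Finite.of_finite_image himg.1 hinj, ?_⟩
  rw [packingNumber, ← hinj.ncard_image]
  exact himg.2

theorem NearTargets.packingNumber_eq (h : NearTargets S g L η δ K f u) (hg : NormLike g)
    (hov : ∀ x y, Overlap S x y ↔ g (x - y) ≤ 1) :
    packingNumber S L η u = (f '' Set.Iio K).ncard +
      {i | K ≤ i ∧ IsPacked S η u i ∧ u i ∈ closedCube d L}.ncard := by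
  obtain ⟨n, hn⟩ := exists_packed_bound hg hov L
  have hfin := (hn η u).1
  have hdisj : Disjoint {i | i < K ∧ IsPacked S η u i}
      {i | K ≤ i ∧ IsPacked S η u i ∧ u i ∈ closedCube d L} := by
    rw [Set.disjoint_left]
    rintro i hi hi'
    exact absurd hi.1 (not_lt.2 hi'.1)
  rw [← h.ncard_prefix hov, packingNumber, ← Set.ncard_union_eq hdisj
    ((Set.finite_Iio K).subset fun i hi => hi.1) (hfin.subset fun i hi => hi.2)]
  congr 1
  ext i
  constructor
  · intro hi
    rcases lt_or_ge i K with hK | hK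
    · exact Or.inl ⟨hK, hi.1⟩
    · exact Or.inr ⟨hK, hi⟩
  · rintro (hi | hi)
    · exact ⟨hi.2, h.mem i hi.1⟩
    · exact hi.2

/-- Changing the initial targets from `fA` to `fB` changes the packing number. -/
theorem packingNumber_ne (hg : NormLike g) (hov : ∀ x y, Overlap S x y ↔ g (x - y) ≤ 1)
    (hA : NearTargets S g L η δ K fA u) (hB : NearTargets S g L η δ K fB v)
    (hag : ∀ i < k, fA i = fB i) (huv : ∀ i, i < k ∨ K ≤ i → u i = v i)
    (himgA : fA '' Set.Iio K ∩ fB '' Set.Iio K ⊆ fA '' Set.Iio k)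
    (himgB : fA '' Set.Iio K ∩ fB '' Set.Iio K ⊆ fB '' Set.Iio k)
    (hcovA : CoversNear g δ (fA '' Set.Iio K \ fB '' Set.Iio K) (fB '' Set.Iio K))
    (hcovB : CoversNear g δ (fB '' Set.Iio K \ fA '' Set.Iio K) (fA '' Set.Iio K))
    (hcard : (fA '' Set.Iio K).ncard ≠ (fB '' Set.Iio K).ncard) :
    packingNumber S L η u ≠ packingNumber S L η v := by
  rw [hA.packingNumber_eq hg hov, hB.packingNumber_eq hg hov]
  have : {i | K ≤ i ∧ IsPacked S η u i ∧ u i ∈ closedCube d L} =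
      {i | K ≤ i ∧ IsPacked S η v i ∧ v i ∈ closedCube d L} := by
    ext i
    refine and_congr_right fun hi => ?_
    rw [isPacked_tail_iff hov hA hB hag huv himgA himgB hcovA hcovB i hi, huv i (Or.inr hi)]
  rw [this]
  omega

end

/-! ### Measurability of the packing number -/

theorem measurableSet_isPacked (hg : NormLike g) {S : ConvexBody (Space d)}
    (hov : ∀ x y, Overlap S x y ↔ g (x - y) ≤ 1) {η : Set (Space d)} (hη : η.Countable) (i : ℕ) :
    MeasurableSet {u : ℕ → Space d | IsPacked S η u i} := by
  have hgm : Measurable g := hg.continuous.measurable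
  induction i using Nat.strong_induction_on with
  | _ i ih =>
    have heq : {u : ℕ → Space d | IsPacked S η u i} =
        (⋂ y ∈ η, {u : ℕ → Space d | 1 < g (u i - y)}) ∩
          ⋂ j ∈ Set.Iio i, ({u : ℕ → Space d | IsPacked S η u j}ᶜ ∪ {u | 1 < g (u i - u j)}) := by
      ext u
      simp only [Set.mem_ofPred_eq, Set.mem_inter_iff, Set.mem_iInter, Set.mem_union,
        Set.mem_compl_iff, Set.mem_Iio]
      rw [isPacked_iff]
      simp only [hov, not_le, imp_iff_not_or]
    rw [heq]
    refine (MeasurableSet.biInter hη fun y _ => ?_).inter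
      (MeasurableSet.biInter (Set.to_countable _) fun j hj => (ih j hj).compl.union ?_)
    · exact measurableSet_lt measurable_const
        (hgm.comp ((measurable_pi_apply i).sub measurable_const))
    · exact measurableSet_lt measurable_const
        (hgm.comp ((measurable_pi_apply i).sub (measurable_pi_apply j)))

theorem measurableSet_closedCube (d : ℕ) (L : ℝ) : MeasurableSet (closedCube d L) := by
  have : closedCube d L = ⋂ k, {x : Space d | 0 ≤ x k ∧ x k ≤ L} := by
    ext x
    simp [closedCube]
  rw [this]
  refine MeasurableSet.iInter fun k => ?_
  have hk : Measurable fun x : Space d => x k := (EuclideanSpace.proj k).continuous.measurable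
  exact (measurableSet_le measurable_const hk).inter (measurableSet_le hk measurable_const)

theorem measurable_packingNumber (hg : NormLike g) {S : ConvexBody (Space d)}
    (hov : ∀ x y, Overlap S x y ↔ g (x - y) ≤ 1) {η : Set (Space d)} (hη : η.Countable) (L : ℝ) :
    Measurable fun u : ℕ → Space d => (packingNumber S L η u : ℝ) := by
  obtain ⟨n, hn⟩ := exists_packed_bound hg hov L
  have hset : ∀ i, MeasurableSet {u : ℕ → Space d | IsPacked S η u i ∧ u i ∈ closedCube d L} :=
    fun i => (measurableSet_isPacked hg hov hη i).inter
      ((measurableSet_closedCube d L).preimage (measurable_pi_apply i))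
  -- Finiteness of the packed set identifies `ncard` with a countable sum of indicators, which is
  -- measurable.
  have heq : (fun u : ℕ → Space d => (packingNumber S L η u : ℝ)) = fun u =>
      (∑' i, {u : ℕ → Space d | IsPacked S η u i ∧ u i ∈ closedCube d L}.indicator
        (fun _ => (1 : ENNReal)) u).toReal := by
    funext u
    have h1 : ∀ i, {u : ℕ → Space d | IsPacked S η u i ∧ u i ∈ closedCube d L}.indicator
        (fun _ => (1 : ENNReal)) u =
        {i | IsPacked S η u i ∧ u i ∈ closedCube d L}.indicator (fun _ => (1 : ENNReal)) i :=
      fun i => rfl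
    simp only [h1]
    rw [← tsum_subtype, ENNReal.tsum_set_one, packingNumber, ← (hn η u).1.cast_ncard_eq]
    simp
  rw [heq]
  exact (Measurable.tsum fun i => measurable_const.indicator (hset i)).ennreal_toReal

/-! ### Exchanging two balls -/

/-- The exchange of the balls of radius `ρ` about `a` and `b` by translation. -/
def swapBalls (a b : Space d) (ρ : ℝ) (z : Space d) : Space d :=
  open Classical in
  if z ∈ Metric.ball a ρ then z + (b - a) else if z ∈ Metric.ball b ρ then z - (b - a) else z

theorem swapBalls_of_mem {a b z : Space d} {ρ : ℝ} (h : z ∈ Metric.ball a ρ) :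
    swapBalls a b ρ z = z + (b - a) := if_pos h

theorem swapBalls_self (a : Space d) (ρ : ℝ) (z : Space d) : swapBalls a a ρ z = z := by
  simp [swapBalls]

theorem measurable_swapBalls (a b : Space d) (ρ : ℝ) : Measurable (swapBalls a b ρ) := by
  classical
  refine Measurable.ite Metric.isOpen_ball.measurableSet (measurable_id.add_const _)
    (Measurable.ite Metric.isOpen_ball.measurableSet (measurable_id.sub_const _) measurable_id)

/-- `Q` splits into the two disjoint balls, exchanged by translation, and a remainder that is fixed.
Only the balls need be measurable, so `E` is arbitrary. -/
theorem volume_preimage_swapBalls {a b : Space d} {ρ : ℝ} (hab : 2 * ρ ≤ dist a b)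
    {Q : Set (Space d)} (ha : Metric.ball a ρ ⊆ Q)
    (hb : Metric.ball b ρ ⊆ Q) (E : Set (Space d)) :
    volume (swapBalls a b ρ ⁻¹' E ∩ Q) = volume (E ∩ Q) := by
  have hdisj : Disjoint (Metric.ball a ρ) (Metric.ball b ρ) :=
    Metric.ball_disjoint_ball (by linarith)
  have hsplit : ∀ T : Set (Space d), volume (T ∩ Q) = volume (T ∩ Metric.ball a ρ) +
      (volume (T ∩ Metric.ball b ρ) +
        volume ((T ∩ Q) \ (Metric.ball a ρ ∪ Metric.ball b ρ))) := by
    intro T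
    rw [← measure_inter_add_sdiff (T ∩ Q) (Metric.isOpen_ball (x := a) (ε := ρ)).measurableSet,
      ← measure_inter_add_sdiff ((T ∩ Q) \ Metric.ball a ρ)
        (Metric.isOpen_ball (x := b) (ε := ρ)).measurableSet, Set.sdiff_sdiff]
    congr 2
    · rw [Set.inter_assoc, Set.inter_eq_right.2 ha]
    · congr 1
      ext z
      constructor
      · rintro ⟨⟨⟨h1, -⟩, -⟩, h2⟩
        exact ⟨h1, h2⟩
      · rintro ⟨h1, h2⟩
        exact ⟨⟨⟨h1, hb h2⟩, fun h3 => Set.disjoint_left.1 hdisj h3 h2⟩, h2⟩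
  have hmem : ∀ z, z + (b - a) ∈ Metric.ball b ρ ↔ z ∈ Metric.ball a ρ := by
    intro z
    rw [mem_ball_iff_norm, mem_ball_iff_norm, show z + (b - a) - b = z - a by abel]
  have hmem' : ∀ z, z + -(b - a) ∈ Metric.ball a ρ ↔ z ∈ Metric.ball b ρ := by
    intro z
    rw [mem_ball_iff_norm, mem_ball_iff_norm, show z + -(b - a) - a = z - b by abel]
  have h1 : swapBalls a b ρ ⁻¹' E ∩ Metric.ball a ρ =
      (fun z => z + (b - a)) ⁻¹' (E ∩ Metric.ball b ρ) := by
    ext z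
    simp only [Set.mem_inter_iff, Set.mem_preimage, hmem]
    refine and_congr_left fun hz => ?_
    rw [swapBalls_of_mem hz]
  have h2 : swapBalls a b ρ ⁻¹' E ∩ Metric.ball b ρ =
      (fun z => z + -(b - a)) ⁻¹' (E ∩ Metric.ball a ρ) := by
    ext z
    simp only [Set.mem_inter_iff, Set.mem_preimage, hmem']
    refine and_congr_left fun hz => ?_
    rw [swapBalls, if_neg fun h => Set.disjoint_left.1 hdisj h hz, if_pos hz, sub_eq_add_neg z]
  have h3 : (swapBalls a b ρ ⁻¹' E ∩ Q) \ (Metric.ball a ρ ∪ Metric.ball b ρ) =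
      (E ∩ Q) \ (Metric.ball a ρ ∪ Metric.ball b ρ) := by
    ext z
    simp only [Set.mem_sdiff, Set.mem_inter_iff, Set.mem_preimage, Set.mem_union, not_or]
    refine and_congr_left fun hz => ?_
    rw [swapBalls, if_neg hz.1, if_neg hz.2]
  rw [hsplit, hsplit E, h1, h2, h3, measure_preimage_add_right, measure_preimage_add_right,
    add_left_comm]

theorem map_swapBalls_uniformCube {a b : Space d} {ρ L : ℝ} (hab : a = b ∨ 2 * ρ ≤ dist a b)
    (ha : Metric.ball a ρ ⊆ halfOpenCube d L) (hb : Metric.ball b ρ ⊆ halfOpenCube d L) :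
    (uniformCube d L).map (swapBalls a b ρ) = uniformCube d L := by
  rcases hab with rfl | hab
  · rw [funext (swapBalls_self a ρ)]
    exact Measure.map_id
  · ext E hE
    have hm := measurable_swapBalls a b ρ
    rw [Measure.map_apply hm hE, uniformCube, ProbabilityTheory.cond, Measure.smul_apply,
      Measure.smul_apply, Measure.restrict_apply hE, Measure.restrict_apply (hm hE),
      volume_preimage_swapBalls hab ha hb]

theorem uniformCube_ball_pos {a : Space d} {ρ L : ℝ} (hρ : 0 < ρ)
    (ha : Metric.ball a ρ ⊆ halfOpenCube d L) : uniformCube d L (Metric.ball a ρ) ≠ 0 := by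
  rw [uniformCube, ProbabilityTheory.cond, Measure.smul_apply,
    Measure.restrict_apply Metric.isOpen_ball.measurableSet, Set.inter_eq_left.2 ha, smul_eq_mul]
  refine mul_ne_zero (ENNReal.inv_ne_zero.2 ?_) (Metric.measure_ball_pos volume a hρ).ne'
  rw [volume_halfOpenCube]
  exact ENNReal.pow_ne_top ENNReal.ofReal_ne_top

/-! ### Placing the two configurations in a cube -/

theorem exists_robust_pair_in_cube (hd : 1 ≤ d) (hg : NormLike g) :
    ∃ (A B : Set (Space d)) (δ L : ℝ), A.Finite ∧ B.Finite ∧ A.ncard ≠ B.ncard ∧ 0 < δ ∧ δ ≤ 1 ∧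
      SeparatedBy g δ A ∧ SeparatedBy g δ B ∧ CoversNear g δ (A \ B) B ∧
      CoversNear g δ (B \ A) A ∧ 0 < L ∧
      ∀ a ∈ A ∪ B, ∀ z, g (z - a) ≤ 3 → z ∈ halfOpenCube d L := by
  obtain ⟨A, B, δ, hA, hB, hne, hδ, hδ1, hsA, hsB, hcA, hcB⟩ := exists_robust_pair hd hg
  obtain ⟨R, hR⟩ := hg.norm_le 3
  obtain ⟨M, hM⟩ : ∃ M : ℝ, ∀ a ∈ A ∪ B, ‖a‖ ≤ M := (hA.union hB).isBounded.exists_norm_le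
  obtain ⟨L, hL⟩ : ∃ L : ℝ, L = 2 * (|M| + |R| + 1) := ⟨_, rfl⟩
  set p : Space d := WithLp.toLp 2 fun _ => L / 2 with hp
  have hinj : Function.Injective fun x : Space d => x + p := add_left_injective p
  have hsep : ∀ T, SeparatedBy g δ T → SeparatedBy g δ ((fun x : Space d => x + p) '' T) := by
    rintro T hT _ ⟨x, hx, rfl⟩ _ ⟨y, hy, rfl⟩ hxy
    have := hT hx hy fun h => hxy (by rw [h])
    simpa using this
  have hcov : ∀ T U, CoversNear g δ (T \ U) U → CoversNear g δ
      ((fun x : Space d => x + p) '' T \ (fun x : Space d => x + p) '' U)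
      ((fun x : Space d => x + p) '' U) := by
    intro T U h
    rw [← Set.image_sdiff hinj]
    rintro _ ⟨a, ha, rfl⟩ z hz
    obtain ⟨x, hx, hxz⟩ := h a ha (z - p) (by rwa [sub_right_comm, sub_sub])
    exact ⟨x + p, ⟨x, hx, rfl⟩, by rwa [← sub_sub, sub_right_comm]⟩
  refine ⟨(fun x : Space d => x + p) '' A, (fun x : Space d => x + p) '' B, δ, L, hA.image _,
    hB.image _, ?_, hδ, hδ1, hsep A hsA, hsep B hsB, hcov A B hcA, hcov B A hcB, ?_, ?_⟩
  · rwa [Set.ncard_image_of_injective _ hinj, Set.ncard_image_of_injective _ hinj]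
  · rw [hL]
    positivity
  · rw [← Set.image_union]
    rintro _ ⟨a, ha, rfl⟩ z hz i
    have h1 : ‖z - p‖ ≤ M + R := by
      have h2 : z - p = a + (z - (a + p)) := by abel
      rw [h2]
      exact (norm_add_le _ _).trans (add_le_add (hM a ha) (hR _ hz))
    have h3 := (abs_coord_le_norm (z - p) i).trans h1
    have h4 : (z - p) i = z i - L / 2 := by simp [hp]
    rw [h4, abs_le] at h3
    constructor <;> linarith [le_abs_self M, le_abs_self R]

/-! ### Enumerating finite sets -/

theorem exists_enumeration_of_nonempty {α : Type*} {T : Set α} (hT : T.Finite)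
    (hne : T.Nonempty) : ∃ (f : ℕ → α) (n₀ : ℕ), ∀ n, n₀ ≤ n → f '' Set.Iio n = T := by
  obtain ⟨f, rfl⟩ := hT.countable.exists_eq_range hne
  choose! j hj using fun x (hx : x ∈ Set.range f) => hx
  obtain ⟨m, hm⟩ := (hT.image j).bddAbove
  refine ⟨f, m + 1, fun n hn => (Set.image_subset_range _ _).antisymm fun x hx => ?_⟩
  exact ⟨j x, lt_of_lt_of_le (Nat.lt_succ_of_le (hm ⟨x, hx, rfl⟩)) hn, hj x hx⟩

theorem exists_enumeration {α : Type*} [Nonempty α] {T : Set α} (hT : T.Finite) :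
    ∃ (f : ℕ → α) (n : ℕ), f '' Set.Iio n = T := by
  rcases T.eq_empty_or_nonempty with rfl | hne
  · exact ⟨fun _ => Classical.arbitrary α, 0, by simp⟩
  · obtain ⟨f, n, h⟩ := exists_enumeration_of_nonempty hT hne
    exact ⟨f, n, h n le_rfl⟩

/-- Two finite nonempty sets are enumerated, with repetitions, by sequences that begin with a common
enumeration of the intersection. -/
theorem exists_joint_enumeration {α : Type*} {A B : Set α} (hA : A.Finite) (hB : B.Finite)
    (hAne : A.Nonempty) (hBne : B.Nonempty) :
    ∃ (fA fB : ℕ → α) (k K : ℕ), (∀ i < k, fA i = fB i) ∧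
      fA '' Set.Iio k = A ∩ B ∧ fA '' Set.Iio K = A ∧ fB '' Set.Iio K = B := by
  classical
  obtain ⟨a₀, -⟩ := id hAne
  have : Nonempty α := ⟨a₀⟩
  obtain ⟨c, k, hc⟩ := exists_enumeration (hA.inter_of_left B)
  obtain ⟨a, n₁, ha⟩ := exists_enumeration_of_nonempty hA hAne
  obtain ⟨b, n₂, hb⟩ := exists_enumeration_of_nonempty hB hBne
  have key : ∀ (e : ℕ → α) (T : Set α), A ∩ B ⊆ T → e '' Set.Iio (n₁ + n₂) = T →
      (fun i => if i < k then c i else e (i - k)) '' Set.Iio (k + (n₁ + n₂)) = T := by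
    intro e T hT he
    ext x
    constructor
    · rintro ⟨i, hi, rfl⟩
      rw [Set.mem_Iio] at hi
      by_cases h : i < k
      · simp only [if_pos h]
        exact hT (hc ▸ ⟨i, h, rfl⟩)
      · simp only [if_neg h]
        rw [← he]
        exact ⟨i - k, by rw [Set.mem_Iio]; omega, rfl⟩
    · intro hx
      rw [← he] at hx
      obtain ⟨i, hi, rfl⟩ := hx
      rw [Set.mem_Iio] at hi
      exact ⟨k + i, by rw [Set.mem_Iio]; omega, by simp⟩
  refine ⟨fun i => if i < k then c i else a (i - k), fun i => if i < k then c i else b (i - k), k,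
    k + (n₁ + n₂), fun i hi => by simp [hi], ?_,
    key a A Set.inter_subset_left (ha _ (by omega)),
    key b B Set.inter_subset_right (hb _ (by omega))⟩
  rw [← hc]
  exact Set.image_congr fun i hi => if_pos hi

/-- A bounded random variable that a measure-preserving map changes by at least `1` on an event has
variance at least a quarter of the probability of that event. -/
theorem variance_ge_of_measurePreserving {Ω : Type*} [MeasurableSpace Ω] {μ : Measure Ω}
    [IsProbabilityMeasure μ] {N : Ω → ℝ} (hN : Measurable N) {b : ℝ} (hb : ∀ ω, |N ω| ≤ b)
    {Φ : Ω → Ω} (hΦ : MeasurePreserving Φ μ μ) {T : Set Ω} (hT : MeasurableSet T)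
    (hgap : ∀ ω ∈ T, 1 ≤ |N ω - N (Φ ω)|) : μ.real T / 4 ≤ variance N μ := by
  rw [variance_eq_integral hN.aemeasurable]
  set m := ∫ ω, N ω ∂μ with hm
  have hF : Measurable fun ω => (N ω - m) ^ 2 := (hN.sub_const m).pow_const 2
  have hInt : Integrable (fun ω => (N ω - m) ^ 2) μ := by
    refine Integrable.of_bound hF.aestronglyMeasurable ((b + |m|) ^ 2) (ae_of_all _ fun ω => ?_)
    rw [Real.norm_eq_abs, abs_pow]
    exact pow_le_pow_left₀ (abs_nonneg _) ((abs_sub _ _).trans (by linarith [hb ω])) 2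
  have hcomp : ∫ ω, (N (Φ ω) - m) ^ 2 ∂μ = ∫ ω, (N ω - m) ^ 2 ∂μ := by
    have h := integral_map (μ := μ) hΦ.measurable.aemeasurable
      (f := fun ω => (N ω - m) ^ 2) hF.aestronglyMeasurable
    rw [hΦ.map_eq] at h
    exact h.symm
  have hInt' : Integrable (fun ω => (N (Φ ω) - m) ^ 2) μ :=
    hΦ.integrable_comp_of_integrable hInt
  have hle : ∫ ω, T.indicator (fun _ => (1 / 2 : ℝ)) ω ∂μ ≤
      ∫ ω, ((N ω - m) ^ 2 + (N (Φ ω) - m) ^ 2) ∂μ := by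
    refine integral_mono ((integrable_const _).indicator hT) (hInt.add hInt') fun ω => ?_
    by_cases hω : ω ∈ T
    · simp only [Set.indicator_of_mem hω]
      have h1 : 1 ≤ (N ω - N (Φ ω)) ^ 2 := (one_le_sq_iff_one_le_abs _).2 (hgap ω hω)
      -- The parallelogram identity: `x² + y² ≥ (x - y)² / 2`.
      nlinarith [sq_nonneg ((N ω - m) + (N (Φ ω) - m))]
    · simp only [Set.indicator_of_notMem hω]
      positivity
  rw [integral_indicator_const _ hT, integral_add hInt hInt', hcomp, smul_eq_mul] at hle
  linarith

end PackingVariability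

/-! ### The exchange and the variance bound -/

theorem proposition4p1 (d : ℕ) (hd : 1 ≤ d) (S : ConvexBody (Space d))
    (hS : (interior (S : Set (Space d))).Nonempty) : JammingVariability S := by
  obtain ⟨g, hg, hov⟩ := exists_overlap_seminorm S hS
  obtain ⟨A, B, δ, L, hA, hB, hne, hδ, hδ1, hsA, hsB, hcA, hcB, hL, hcube⟩ :=
    exists_robust_pair_in_cube hd hg
  have hnonempty : ∀ {T U : Set (Space d)}, CoversNear g δ (T \ U) U → T.Nonempty →
      U.Nonempty := by
    rintro T U h ⟨t, ht⟩
    by_cases hU : t ∈ U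
    · exact ⟨t, hU⟩
    · obtain ⟨x, hx, -⟩ := h t ⟨ht, hU⟩ t (by rw [sub_self, map_zero]; linarith)
      exact ⟨x, hx⟩
  have hAB : A.Nonempty ∧ B.Nonempty := by
    rcases A.eq_empty_or_nonempty with rfl | hAne
    · have hBne : B.Nonempty := by
        rw [Set.nonempty_iff_ne_empty]
        rintro rfl
        exact hne rfl
      exact absurd (hnonempty hcB hBne) Set.not_nonempty_empty
    · exact ⟨hAne, hnonempty hcA hAne⟩
  obtain ⟨fA, fB, k, K, hag, himg, hfA, hfB⟩ := exists_joint_enumeration hA hB hAB.1 hAB.2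
  have himg' : fB '' Set.Iio k = A ∩ B := by
    rw [← himg]
    exact Set.image_congr fun i hi => (hag i hi).symm
  obtain ⟨r, hr, hrdist⟩ : ∃ r : ℝ, 0 < r ∧ ∀ x ∈ A ∪ B, ∀ y ∈ A ∪ B, x ≠ y → r ≤ dist x y := by
    obtain ⟨r, hr, h⟩ := (hA.union hB).relatively_discrete
    refine ⟨(min r 1).toReal, ENNReal.toReal_pos (lt_min hr one_pos).ne'
      (min_lt_of_right_lt ENNReal.one_lt_top).ne, fun x hx y hy hxy => ?_⟩
    rw [dist_edist]
    exact ENNReal.toReal_mono (edist_ne_top _ _) ((min_le_left _ _).trans (h x hx y hy hxy))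
  obtain ⟨C, hC, hgC⟩ := hg.upper
  -- Balls about distinct targets are then disjoint, and each lies within `g`-distance `δ / 2` of
  -- its centre.
  obtain ⟨ρ, hρ, hρr, hρδ⟩ : ∃ ρ : ℝ, 0 < ρ ∧ 2 * ρ ≤ r ∧ C * ρ ≤ δ / 2 := by
    refine ⟨min (r / 2) (δ / 2 / C), lt_min (by positivity) (by positivity), ?_, ?_⟩
    · linarith [min_le_left (r / 2) (δ / 2 / C)]
    · rw [← le_div_iff₀' hC]
      exact min_le_right _ _
  have hmemA : ∀ i < K, fA i ∈ A := fun i hi => hfA ▸ ⟨i, hi, rfl⟩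
  have hmemB : ∀ i < K, fB i ∈ B := fun i hi => hfB ▸ ⟨i, hi, rfl⟩
  have hgball : ∀ a z : Space d, z ∈ Metric.ball a ρ → g (z - a) ≤ δ / 2 := by
    intro a z hz
    rw [mem_ball_iff_norm] at hz
    exact (hgC _).trans ((mul_le_mul_of_nonneg_left hz.le hC.le).trans hρδ)
  have hball : ∀ a ∈ A ∪ B, Metric.ball a ρ ⊆ halfOpenCube d L := fun a ha z hz =>
    hcube a ha z (by linarith [hgball a z hz])
  -- A point of `η` overlapping an arrival near a target would be within `1 + δ/2 ≤ 3` of that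
  -- target, hence inside the cube. This makes the estimate uniform in `η`.
  have hnear : ∀ (η : Set (Space d)), Admissible S L η → ∀ (f u : ℕ → Space d),
      SeparatedBy g δ (f '' Set.Iio K) → (∀ i < K, f i ∈ A ∪ B) →
      (∀ i < K, u i ∈ Metric.ball (f i) ρ) → NearTargets S g L η δ K f u := by
    intro η hη f u hf hfm hu
    refine ⟨hδ1, hδ.le, hf, fun i hi => hgball _ _ (hu i hi), fun i hi y hy hO => ?_,
      fun i hi l => ?_⟩
    · rw [hov, seminorm_sub_rev] at hO
      have h1 := hgball _ _ (hu i hi)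
      have h2 := hcube (f i) (hfm i hi) y (by linarith [seminorm_sub_le g y (u i) (f i)])
      exact hη.1 hy fun l => ⟨(h2 l).1, (h2 l).2.le⟩
    · have h := hball _ (hfm i hi) (hu i hi) l
      exact ⟨h.1, h.2.le⟩
  have : IsProbabilityMeasure (uniformCube d L) := isProbabilityMeasure_uniformCube d hL
  have hlaw : arrivalLaw d L hL = Measure.infinitePi fun _ : ℕ => uniformCube d L := rfl
  have : IsProbabilityMeasure (arrivalLaw d L hL) := by
    rw [hlaw]
    infer_instance
  set φ : ℕ → Space d → Space d := fun i => if i < K then swapBalls (fA i) (fB i) ρ else id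
    with hφ
  have hφm : ∀ i, Measurable (φ i) := by
    intro i
    by_cases hi : i < K
    · simp only [hφ, if_pos hi]
      exact measurable_swapBalls _ _ _
    · simp only [hφ, if_neg hi]
      exact measurable_id
  have hφmap : ∀ i, (uniformCube d L).map (φ i) = uniformCube d L := by
    intro i
    by_cases hi : i < K
    · simp only [hφ, if_pos hi]
      refine map_swapBalls_uniformCube ?_ (hball _ (Or.inl (hmemA i hi)))
        (hball _ (Or.inr (hmemB i hi)))
      by_cases heq : fA i = fB i
      · exact Or.inl heq
      · exact Or.inr (hρr.trans
          (hrdist _ (Or.inl (hmemA i hi)) _ (Or.inr (hmemB i hi)) heq))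
    · simp only [hφ, if_neg hi]
      exact Measure.map_id
  set Φ : (ℕ → Space d) → ℕ → Space d := fun u i => φ i (u i) with hΦ
  have hΦp : MeasurePreserving Φ (arrivalLaw d L hL) (arrivalLaw d L hL) := by
    refine ⟨measurable_pi_lambda _ fun i => (hφm i).comp (measurable_pi_apply i), ?_⟩
    rw [hlaw, hΦ, Measure.infinitePi_map_pi _ hφm]
    simp only [hφmap]
  set T : Set (ℕ → Space d) :=
    (↑(Finset.range K) : Set ℕ).pi fun i => Metric.ball (fA i) ρ with hT
  have hTm : MeasurableSet T :=
    MeasurableSet.pi (Set.to_countable _) fun i _ => Metric.isOpen_ball.measurableSet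
  have hTpos : 0 < (arrivalLaw d L hL).real T := by
    rw [measureReal_def]
    refine ENNReal.toReal_pos ?_ (measure_ne_top _ _)
    rw [hlaw, hT, Measure.infinitePi_pi _ fun i _ => Metric.isOpen_ball.measurableSet]
    refine Finset.prod_ne_zero_iff.2 fun i hi => ?_
    exact uniformCube_ball_pos hρ (hball _ (Or.inl (hmemA i (Finset.mem_range.1 hi))))
  refine ⟨L, hL, (arrivalLaw d L hL).real T / 4, by positivity, fun η hη => ?_⟩
  -- Countability of `η` is what makes the packing events measurable.
  have hηc : η.Countable := by
    refine HardCore.countable hg fun x hx y hy hxy => ?_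
    have h : ¬ Overlap S x y := hη.2 hx hy hxy
    rwa [hov, not_le] at h
  obtain ⟨n, hn⟩ := exists_packed_bound (S := S) hg hov L
  refine variance_ge_of_measurePreserving (measurable_packingNumber hg hov hηc L) (b := n)
    (fun u => ?_) hΦp hTm fun u hu => ?_
  · rw [Nat.abs_cast]
    exact_mod_cast (hn η u).2
  · have huA : ∀ i < K, u i ∈ Metric.ball (fA i) ρ := fun i hi =>
      hu i (Finset.mem_coe.2 (Finset.mem_range.2 hi))
    have huB : ∀ i < K, Φ u i ∈ Metric.ball (fB i) ρ := by
      intro i hi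
      have h1 := huA i hi
      have h2 : Φ u i = u i + (fB i - fA i) := by
        simp only [hΦ, hφ, if_pos hi]
        exact swapBalls_of_mem h1
      rw [mem_ball_iff_norm] at h1 ⊢
      rwa [h2, show u i + (fB i - fA i) - fB i = u i - fA i by abel]
    have hkK : ∀ i, i < k ∨ K ≤ i → u i = Φ u i := by
      intro i hi
      by_cases hiK : i < K
      · have hik : i < k := by omega
        simp only [hΦ, hφ, if_pos hiK, hag i hik, swapBalls_self]
      · simp only [hΦ, hφ, if_neg hiK, id]
    have hne' := packingNumber_ne (S := S) (L := L) (η := η) hg hov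
      (hnear η hη fA u (hfA ▸ hsA) (fun i hi => Or.inl (hmemA i hi)) huA)
      (hnear η hη fB (Φ u) (hfB ▸ hsB) (fun i hi => Or.inr (hmemB i hi)) huB)
      hag hkK (by rw [hfA, hfB, himg]) (by rw [hfA, hfB, himg']) (by rwa [hfA, hfB])
      (by rwa [hfA, hfB]) (by rwa [hfA, hfB])
    have h1 : (1 : ℤ) ≤ |(packingNumber S L η u : ℤ) - packingNumber S L η (Φ u)| :=
      Int.one_le_abs (sub_ne_zero.2 (by exact_mod_cast hne'))
    exact_mod_cast h1
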